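/- Let $\mathcal M$ be a von Neumann algebra acting on a complex Hilbert space $\mathcal H$, let $A\in\mathcal M$ be a nonzero positive operator, and let $P\in\mathcal M$ be the orthogonal projection onto the closure of the range of $A$. For $T\in\mathcal M$ put $$\|T\|_A=\sup\{\sqrt{f(T^*AT)} : f \text{ a positive linear functional on } \mathcal M,\ f(A)=1\}\in[0,\infty],\qquad \mathcal M^A=\{T\in\mathcal M:\|T\|_A<\infty\}.$$ An element $T\in\mathcal M^A$ is called left (respectively right) $A$-invertible if there is $S\in\mathcal M^A$ with $AST=A$ (respectively $ATS=A$), and $A$-invertible if there is $S\in\mathcal M^A$ with $ATS=AST=A$. The $A$-spectrum $\sigma_A(T)$ (respectively the left $A$-spectrum $\sigma_A^l(T)$, the right $A$-spectrum $\sigma_A^r(T)$) is the set of $\lambda\in\mathbb C$ such that $\lambda I-T$ is not $A$-invertible (respectively not left, not right $A$-invertible). For $X\in\mathcal M$, $\sigma(X)$ denotes the spectrum of $X$ in $\mathcal M$, and $\mathcal P^r(X)$ denotes the set of pure states $g$ of $\mathcal M$ with $g(XS)=g(X)g(S)$ for all $S\in\mathcal M$. The element $A$ is called well-supported if $\sigma(A)\setminus\{0\}$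 is closed. Proposition 2.8. Suppose that $A$ is well-supported and that $T,L\in\mathcal M^A$ satisfy $AL=T^*A$. Then $$\sigma_A(T)\setminus\{0\}=\sigma(PT)\setminus\{0\},$$ $$\sigma_A^r(T)\setminus\{0\}=\{g(T): g\in\mathcal P^r(T),\ g(P)=1\}\setminus\{0\},$$ $$\sigma_A^l(T)\setminus\{0\}=\{\overline{g(L)}: g\in\mathcal P^r(L),\ g(P)=1\}\setminus\{0\}.$$ In particular, if $AT$ is self-adjoint, then $\sigma_A(T)\subseteq\sigma(T)$. -/

import Mathlib

open scoped ComplexOrder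

noncomputable section

namespace ASpectrum

universe u

variable {H : Type u} [NormedAddCommGroup H] [InnerProductSpace ℂ H] [CompleteSpace H]

/-- A bounded linear functional `f` on the von Neumann algebra `M` is positive if `f X ≥ 0`
(in particular `f X` is real) for every positive operator `X` in `M`. -/
def IsPositiveFunctional (M : VonNeumannAlgebra H)
    (f : StrongDual ℂ M.toStarSubalgebra) : Prop :=
  ∀ X : M.toStarSubalgebra, (X : H →L[ℂ] H).IsPositive → 0 ≤ f X

/-- States of `M`: positive functionals taking the value `1` at the identity operator
(equivalently, positive functionals of norm `1`). -/
def IsState (M : VonNeumannAlgebra H) (f : StrongDual ℂ M.toStarSubalgebra) : Prop :=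
  IsPositiveFunctional M f ∧ f 1 = 1

/-- Pure states of `M`: states `f` such that every positive functional `g` with `g ≤ f` on the
positive cone of `M` is of the form `α f` with `0 ≤ α ≤ 1`. -/
def IsPureState (M : VonNeumannAlgebra H) (f : StrongDual ℂ M.toStarSubalgebra) : Prop :=
  IsState M f ∧
    ∀ g : StrongDual ℂ M.toStarSubalgebra, IsPositiveFunctional M g →
      (∀ X : M.toStarSubalgebra, (X : H →L[ℂ] H).IsPositive → g X ≤ f X) →
      ∃ α : ℝ, 0 ≤ α ∧ α ≤ 1 ∧ g = (α : ℂ) • f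

/-- The `A`-seminorm `‖T‖_A = sup √(f(T⋆ A T))`, the supremum being taken in `[0, ∞]` over all
positive functionals `f` on `M` with `f(A) = 1`. -/
def aSeminorm (M : VonNeumannAlgebra H) (A T : M.toStarSubalgebra) : ENNReal :=
  ⨆ f : {f : StrongDual ℂ M.toStarSubalgebra // IsPositiveFunctional M f ∧ f A = 1},
    ENNReal.ofReal (Real.sqrt (f.1 (star T * A * T)).re)

/-- The set `M^A` of the elements of `M` with finite `A`-seminorm. -/
def aBounded (M : VonNeumannAlgebra H) (A : M.toStarSubalgebra) : Set M.toStarSubalgebra :=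
  {T | aSeminorm M A T < ⊤}

/-- `A` is well-supported if `σ(A) \ {0}` is closed. -/
def WellSupported (M : VonNeumannAlgebra H) (A : M.toStarSubalgebra) : Prop :=
  IsClosed (spectrum ℂ A \ {0})

/-- `T` is left `A`-invertible in `M^A`: `A S T = A` for some `S` in `M^A`. -/
def IsLeftAInvertible (M : VonNeumannAlgebra H) (A T : M.toStarSubalgebra) : Prop :=
  ∃ S ∈ aBounded M A, A * S * T = A

/-- `T` is right `A`-invertible in `M^A`: `A T S = A` for some `S` in `M^A`. -/
def IsRightAInvertible (M : VonNeumannAlgebra H) (A T : M.toStarSubalgebra) : Prop :=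
  ∃ S ∈ aBounded M A, A * T * S = A

/-- `T` is `A`-invertible in `M^A`: `A T S = A S T = A` for some `S` in `M^A`. -/
def IsAInvertible (M : VonNeumannAlgebra H) (A T : M.toStarSubalgebra) : Prop :=
  ∃ S ∈ aBounded M A, A * T * S = A ∧ A * S * T = A

/-- The `A`-spectrum `σ_A(T)`. -/
def aSpectrum (M : VonNeumannAlgebra H) (A T : M.toStarSubalgebra) : Set ℂ :=
  {z | ¬ IsAInvertible M A (z • (1 : M.toStarSubalgebra) - T)}

/-- The left `A`-spectrum of `T`. -/
def leftASpectrum (M : VonNeumannAlgebra H) (A T : M.toStarSubalgebra) : Set ℂ :=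
  {z | ¬ IsLeftAInvertible M A (z • (1 : M.toStarSubalgebra) - T)}

/-- The right `A`-spectrum of `T`. -/
def rightASpectrum (M : VonNeumannAlgebra H) (A T : M.toStarSubalgebra) : Set ℂ :=
  {z | ¬ IsRightAInvertible M A (z • (1 : M.toStarSubalgebra) - T)}

/-- The pure states of `M` that are right-multiplicative at `T`:
`g(T S) = g(T) g(S)` for every `S` in `M`. -/
def rightMulPureStates (M : VonNeumannAlgebra H) (T : M.toStarSubalgebra) :
    Set (StrongDual ℂ M.toStarSubalgebra) :=
  {g | IsPureState M g ∧ ∀ S : M.toStarSubalgebra, g (T * S) = g T * g S}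

/-- The orthogonal projection of `H` onto the closure of the range of `A` belongs to `M`. -/
theorem starProjection_range_mem (M : VonNeumannAlgebra H) (A : M.toStarSubalgebra) :
    (A : H →L[ℂ] H).range.topologicalClosure.starProjection ∈ M.toStarSubalgebra := by
  change _ ∈ M
  rw [VonNeumannAlgebra.IsStarProjection.mem_iff isStarProjection_starProjection]
  intro y hy
  rw [Submodule.range_starProjection, Module.End.mem_invtSubmodule]
  have hc := VonNeumannAlgebra.mem_commutant_iff.1 hy (A : H →L[ℂ] H) A.2
  have h : ∀ x ∈ closure ((A : H →L[ℂ] H).range : Set H),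
      y x ∈ closure ((A : H →L[ℂ] H).range : Set H) := by
    intro x hx
    refine map_mem_closure y.continuous hx ?_
    rintro _ ⟨w, rfl⟩
    exact ⟨y w, congrArg (fun Z : H →L[ℂ] H => Z w) hc⟩
  intro x hx
  exact h x hx

/-- The orthogonal projection `P` onto the closure of the range of `A`, as an element of `M`. -/
def rangeProjection (M : VonNeumannAlgebra H) (A : M.toStarSubalgebra) : M.toStarSubalgebra :=
  ⟨(A : H →L[ℂ] H).range.topologicalClosure.starProjection, starProjection_range_mem M A⟩

end ASpectrum

end

open scoped ComplexOrder

noncomputable section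

namespace ASpectrum

open scoped InnerProductSpace

universe u

variable {H : Type u} [NormedAddCommGroup H] [InnerProductSpace ℂ H] [CompleteSpace H]

/-! ### Invertibility and positivity in a von Neumann algebra -/

/-! Everything reduces to the corner `P M P`. Well-supportedness makes 0 at most an isolated point
of `σ(A)`, so `A` has a Moore–Penrose inverse `B` in `M` with `AB = BA = P`, and `P ≤ cA`. Hence `AX
= A` iff `PX = P`, and `T ∈ M^A` iff `PT = PTP` (`mem_aBounded_iff`). For such `T` the element `z -
PT` is the block sum of `P(z - T)P` and `z(1 - P)`; for `z ≠ 0` it is invertible iff its corner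
block is, which gives the first identity.

For the right spectrum (`not_isRightAInvertible_iff`), put `Y = PX`. If `X` is not right
`A`-invertible, the positive element `YY* + (1 - P)` is singular, so by Krein–Milman some pure state
`g` annihilates it. Then `g(P) = 1`, and Cauchy–Schwarz gives `g(XS) = 0` for all `S`. The relation
`AL = T*A` turns left invertibility of `z - T` into right invertibility of `conj z - L`. Both of
these descriptions also hold at 0.

If `AT` is self-adjoint, the states so obtained take real values at `T`, which settles nonreal `z`;
for real `z` an ordinary inverse of `z - T` already lies in `M^A`. -/

theorem mem_of_commute (M : VonNeumannAlgebra H) {X : H →L[ℂ] H}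
    (h : ∀ Y ∈ M.commutant, Y * X = X * Y) : X ∈ M.toStarSubalgebra := by
  change X ∈ M
  rw [← VonNeumannAlgebra.commutant_commutant M, VonNeumannAlgebra.mem_commutant_iff]
  exact h

theorem commutant_commute (M : VonNeumannAlgebra H) (X : M.toStarSubalgebra) {Y : H →L[ℂ] H}
    (hY : Y ∈ M.commutant) : Y * (X : H →L[ℂ] H) = X * Y :=
  (VonNeumannAlgebra.mem_commutant_iff.1 hY (X : H →L[ℂ] H) X.2).symm

/-- An inverse commutes with whatever the element commutes with, so the double commutant theorem
puts it back in `M`. -/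
theorem isUnit_iff_isUnit_coe (M : VonNeumannAlgebra H) (X : M.toStarSubalgebra) :
    IsUnit X ↔ IsUnit (X : H →L[ℂ] H) := by
  refine ⟨fun h => h.map M.toStarSubalgebra.subtype, ?_⟩
  rintro ⟨V, hV⟩
  have hmem : (↑V⁻¹ : H →L[ℂ] H) ∈ M.toStarSubalgebra := by
    refine mem_of_commute M fun Y hY => ?_
    have h := commutant_commute M X hY
    rw [← hV] at h
    have h' : Commute Y (V : H →L[ℂ] H) := h
    exact h'.units_inv_right
  refine isUnit_iff_exists.2 ⟨⟨_, hmem⟩, Subtype.ext ?_, Subtype.ext ?_⟩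
  · simp [← hV]
  · simp [← hV]

theorem spectrum_coe (M : VonNeumannAlgebra H) (X : M.toStarSubalgebra) :
    spectrum ℂ (X : H →L[ℂ] H) = spectrum ℂ X := by
  ext z
  rw [spectrum.mem_iff, spectrum.mem_iff, isUnit_iff_isUnit_coe]
  rfl

theorem star_mul_self_isPositive (M : VonNeumannAlgebra H) (X : M.toStarSubalgebra) :
    ((star X * X : M.toStarSubalgebra) : H →L[ℂ] H).IsPositive :=
  ContinuousLinearMap.isPositive_adjoint_comp_self (X : H →L[ℂ] H)

/-! ### The range projection -/

section RangeProjection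

variable {M : VonNeumannAlgebra H} {A : M.toStarSubalgebra}

theorem rangeProjection_mul_self :
    rangeProjection M A * rangeProjection M A = rangeProjection M A :=
  Subtype.ext (isStarProjection_starProjection (𝕜 := ℂ)
    (U := (A : H →L[ℂ] H).range.topologicalClosure)).isIdempotentElem

theorem star_rangeProjection : star (rangeProjection M A) = rangeProjection M A :=
  Subtype.ext (isStarProjection_starProjection (𝕜 := ℂ)
    (U := (A : H →L[ℂ] H).range.topologicalClosure)).isSelfAdjoint

theorem rangeProjection_mul : rangeProjection M A * A = A := by
  refine Subtype.ext (ContinuousLinearMap.ext fun x => ?_)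
  refine Submodule.starProjection_eq_self_iff.2 ?_
  exact Submodule.le_topologicalClosure _ ⟨x, rfl⟩

theorem mul_rangeProjection (hA : (A : H →L[ℂ] H).IsPositive) :
    A * rangeProjection M A = A := by
  have hs : star A = A := Subtype.ext hA.isSelfAdjoint
  have := congrArg star (rangeProjection_mul (M := M) (A := A))
  rwa [star_mul, star_rangeProjection, hs] at this

theorem rangeProjection_mul_eq_self_of_mul_eq {Q : M.toStarSubalgebra}
    (hQ : Q * A = A) : Q * rangeProjection M A = rangeProjection M A := by
  have hcl : ∀ y ∈ closure ((A : H →L[ℂ] H).range : Set H), (Q : H →L[ℂ] H) y = y := by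
    intro y hy
    refine closure_minimal ?_ (isClosed_eq (Q : H →L[ℂ] H).continuous continuous_id) hy
    rintro _ ⟨x, rfl⟩
    exact congrArg (fun Z : M.toStarSubalgebra => (Z : H →L[ℂ] H) x) hQ
  refine Subtype.ext (ContinuousLinearMap.ext fun x => ?_)
  exact hcl _ (Submodule.starProjection_apply_mem (A : H →L[ℂ] H).range.topologicalClosure x)

end RangeProjection

/-- The Moore–Penrose inverse of a well-supported positive element. -/
theorem exists_pseudoinverse {M : VonNeumannAlgebra H} {A : M.toStarSubalgebra}
    (hA : (A : H →L[ℂ] H).IsPositive) (hws : WellSupported M A) :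
    ∃ B : M.toStarSubalgebra, star B = B ∧ A * B = rangeProjection M A ∧
      B * A = rangeProjection M A ∧ rangeProjection M A * B = B ∧ B * rangeProjection M A = B := by
  set a : H →L[ℂ] H := (A : H →L[ℂ] H) with ha
  have hsa : IsSelfAdjoint a := hA.isSelfAdjoint
  -- If 0 lies in the spectrum it is isolated there, so inversion with `0⁻¹ = 0` is continuous on
  -- the spectrum.
  have hcont : ContinuousOn (fun t : ℝ => t⁻¹) (spectrum ℝ a) := by
    have hclosed : IsClosed (spectrum ℝ a \ {0}) := by
      have : spectrum ℝ a \ {0} = (fun t : ℝ => (t : ℂ)) ⁻¹' (spectrum ℂ A \ {0}) := by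
        ext t
        rw [← spectrum_coe]
        simp only [Set.mem_sdiff, Set.mem_singleton_iff, Set.mem_preimage, Complex.ofReal_eq_zero]
        rw [← spectrum.algebraMap_mem_iff ℂ (r := t)]
        rfl
      rw [this]
      exact IsClosed.preimage Complex.continuous_ofReal hws
    intro t ht
    by_cases h0 : t = 0
    · subst h0
      have hnear : ∀ᶠ s in nhdsWithin 0 (spectrum ℝ a), s⁻¹ = (0 : ℝ) := by
        have hopen : (spectrum ℝ a \ {0})ᶜ ∈ nhds (0 : ℝ) :=
          hclosed.isOpen_compl.mem_nhds (by simp)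
        filter_upwards [mem_nhdsWithin_of_mem_nhds hopen, self_mem_nhdsWithin] with s hs hs'
        by_contra hne
        exact hs ⟨hs', fun h => hne (by simp [Set.mem_singleton_iff.1 h])⟩
      refine (continuousWithinAt_const (b := (0 : ℝ))).congr_of_eventuallyEq hnear (by simp)
    · exact (continuousAt_inv₀ h0).continuousWithinAt
  set b : H →L[ℂ] H := cfc (fun t : ℝ => t⁻¹) a with hb
  have hbM : b ∈ M.toStarSubalgebra := by
    refine mem_of_commute M fun Y hY => ?_
    have h : Commute a Y := (commutant_commute M A hY).symm
    exact (h.cfc_real (fun t : ℝ => t⁻¹)).eq.symm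
  have haid : cfc (fun t : ℝ => t) a = a := cfc_id' ℝ a
  have hid : ContinuousOn (fun t : ℝ => t) (spectrum ℝ a) := continuousOn_id
  have hidinv : ContinuousOn (fun t : ℝ => t * t⁻¹) (spectrum ℝ a) := hid.mul hcont
  have hab : a * b = cfc (fun t : ℝ => t * t⁻¹) a :=
    calc a * b = cfc (fun t : ℝ => t) a * b := by rw [haid]
      _ = _ := (cfc_mul _ _ a hid hcont).symm
  have hba : b * a = a * b := ((Commute.refl a).cfc_real (fun t : ℝ => t⁻¹)).eq
  have haba : a * b * a = a :=
    calc a * b * a = cfc (fun t : ℝ => t * t⁻¹) a * cfc (fun t : ℝ => t) a := by rw [hab, haid]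
      _ = cfc (fun t : ℝ => t * t⁻¹ * t) a := (cfc_mul _ _ a hidinv hid).symm
      _ = cfc (fun t : ℝ => t) a := cfc_congr fun t _ => mul_inv_mul_cancel t
      _ = a := haid
  have hbab : b * a * b = b :=
    calc b * a * b = cfc (fun t : ℝ => t * t⁻¹) a * b := by rw [hba, hab]
      _ = cfc (fun t : ℝ => t * t⁻¹ * t⁻¹) a := (cfc_mul _ _ a hidinv hcont).symm
      _ = b := cfc_congr fun t _ => by by_cases h : t = 0 <;> simp [h]
  have hbs : star b = b := (cfc_predicate (fun t : ℝ => t⁻¹) a : IsSelfAdjoint b)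
  set B : M.toStarSubalgebra := ⟨b, hbM⟩ with hB
  have hBs : star B = B := Subtype.ext hbs
  have hBA : B * A = A * B := Subtype.ext hba
  have hABA : A * B * A = A := Subtype.ext haba
  have hBAB : B * A * B = B := Subtype.ext hbab
  have hAB : A * B = rangeProjection M A := by
    -- `AB` fixes the range of `A`, so `ABP = P`, while the adjoint of `PAB = AB` reads `ABP = AB`.
    have h1 := rangeProjection_mul_eq_self_of_mul_eq hABA
    have h2 : rangeProjection M A * (A * B) = A * B := by
      rw [← mul_assoc, rangeProjection_mul]
    have h3 : star (A * B) = A * B := by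
      rw [star_mul, hBs, (Subtype.ext hsa : star A = A), hBA]
    have h4 := congrArg star h2
    rw [star_mul, h3, star_rangeProjection] at h4
    rw [← h4, h1]
  refine ⟨B, hBs, hAB, hBA.trans hAB, ?_, ?_⟩
  · rw [← hAB, ← hBA, hBAB]
  · rw [← hAB, ← mul_assoc, hBAB]

theorem exists_sqrt {M : VonNeumannAlgebra H} {A : M.toStarSubalgebra}
    (hA : (A : H →L[ℂ] H).IsPositive) :
    ∃ C : M.toStarSubalgebra, star C = C ∧ C * C = A := by
  have h0 : 0 ≤ (A : H →L[ℂ] H) := (ContinuousLinearMap.nonneg_iff_isPositive _).2 hA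
  have hmem : CFC.sqrt (A : H →L[ℂ] H) ∈ M.toStarSubalgebra := by
    refine mem_of_commute M fun Y hY => ?_
    have h : Commute (A : H →L[ℂ] H) Y := (commutant_commute M A hY).symm
    exact (h.cfcₙ_nnreal NNReal.sqrt).eq.symm
  exact ⟨⟨_, hmem⟩, Subtype.ext (CFC.sqrt_nonneg _).isSelfAdjoint,
    Subtype.ext (CFC.sqrt_mul_sqrt_self _ h0)⟩

/-- This is `P ≤ cA`. With `C` the square root of `A`, `P = BA = (BC)C` and `‖Cx‖² = ⟪x, Ax⟫`, so `c
= ‖BC‖²` works. -/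
theorem exists_rangeProjection_le {M : VonNeumannAlgebra H} {A : M.toStarSubalgebra}
    (hA : (A : H →L[ℂ] H).IsPositive) (hws : WellSupported M A) :
    ∃ c : ℝ, 0 ≤ c ∧ ∀ x : H,
      ‖(rangeProjection M A : H →L[ℂ] H) x‖ ^ 2 ≤ c * (⟪x, (A : H →L[ℂ] H) x⟫_ℂ).re := by
  obtain ⟨B, -, -, hBA, -, -⟩ := exists_pseudoinverse hA hws
  obtain ⟨C, hCs, hCC⟩ := exists_sqrt hA
  have hnorm : ∀ x, ‖(C : H →L[ℂ] H) x‖ ^ 2 = (⟪x, (A : H →L[ℂ] H) x⟫_ℂ).re := by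
    intro x
    have hs : ContinuousLinearMap.adjoint (C : H →L[ℂ] H) = C := congrArg Subtype.val hCs
    have hx : (A : H →L[ℂ] H) x = (C : H →L[ℂ] H) ((C : H →L[ℂ] H) x) := by rw [← hCC]; rfl
    rw [hx, ← ContinuousLinearMap.adjoint_inner_left, hs, inner_self_eq_norm_sq_to_K]
    norm_cast
  refine ⟨‖((B * C : M.toStarSubalgebra) : H →L[ℂ] H)‖ ^ 2, by positivity, fun x => ?_⟩
  have hx : (rangeProjection M A : H →L[ℂ] H) x
      = ((B * C : M.toStarSubalgebra) : H →L[ℂ] H) ((C : H →L[ℂ] H) x) := by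
    rw [← hBA, ← hCC, ← mul_assoc]; rfl
  rw [← hnorm, ← mul_pow, hx]
  gcongr
  exact ContinuousLinearMap.le_opNorm _ _

/-! ### Positive functionals -/

/-- The vector functional `X ↦ ⟪x, X x⟫`. -/
def vectorFunctional (M : VonNeumannAlgebra H) (x : H) : StrongDual ℂ M.toStarSubalgebra :=
  (innerSL ℂ x).comp ((ContinuousLinearMap.apply ℂ H x).comp
    (Submodule.subtypeL (Subalgebra.toSubmodule M.toStarSubalgebra.toSubalgebra)))

theorem vectorFunctional_apply (M : VonNeumannAlgebra H) (x : H) (X : M.toStarSubalgebra) :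
    vectorFunctional M x X = ⟪x, (X : H →L[ℂ] H) x⟫_ℂ := rfl

theorem isPositiveFunctional_vectorFunctional (M : VonNeumannAlgebra H) (x : H) :
    IsPositiveFunctional M (vectorFunctional M x) := fun _ hX => hX.inner_nonneg_right x

section Functional

variable {M : VonNeumannAlgebra H} {f g : StrongDual ℂ M.toStarSubalgebra}

theorem IsPositiveFunctional.add (hf : IsPositiveFunctional M f) (hg : IsPositiveFunctional M g) :
    IsPositiveFunctional M (f + g) := fun X hX => add_nonneg (hf X hX) (hg X hX)

theorem IsPositiveFunctional.smul (hf : IsPositiveFunctional M f) {r : ℝ} (hr : 0 ≤ r) :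
    IsPositiveFunctional M ((r : ℂ) • f) := fun X hX =>
  mul_nonneg (by exact_mod_cast hr) (hf X hX)

theorem IsPositiveFunctional.apply_star_mul_self_nonneg (hf : IsPositiveFunctional M f)
    (X : M.toStarSubalgebra) : 0 ≤ f (star X * X) :=
  hf _ (star_mul_self_isPositive M X)

/-- The null case of the Cauchy–Schwarz inequality. -/
theorem IsPositiveFunctional.apply_mul_eq_zero (hf : IsPositiveFunctional M f)
    {X : M.toStarSubalgebra} (hX : f (X * star X) = 0) (Y : M.toStarSubalgebra) :
    f (X * Y) = 0 := by
  have key : ∀ s : ℂ, 0 ≤ star s * f (X * Y) + s * f (star Y * star X) + f (star Y * Y) := by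
    intro s
    have h := hf.apply_star_mul_self_nonneg (s • star X + Y)
    have e : star (s • star X + Y) * (s • star X + Y)
        = (s * star s) • (X * star X) + star s • (X * Y) + s • (star Y * star X)
          + star Y * Y := by
      simp only [star_add, star_smul, star_star, add_mul, mul_add, smul_mul_assoc,
        mul_smul_comm, smul_add, smul_smul]
      abel
    rw [e] at h
    simpa [hX] using h
  have hd : (f (star Y * Y)).im = 0 :=
    (Complex.nonneg_iff.1 (hf.apply_star_mul_self_nonneg Y)).2.symm
  set w := f (X * Y)
  set v := f (star Y * star X)
  set d := f (star Y * Y)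
  have k1 := fun t : ℝ => Complex.nonneg_iff.1 (key (t : ℂ))
  have k2 := fun t : ℝ => Complex.nonneg_iff.1 (key (t * Complex.I))
  simp [hd] at k1 k2
  -- With no quadratic term in `s`, positivity bounds an affine function of `t` from below on the
  -- whole line, so its slope is 0. Real and imaginary `s` together give `w = 0`.
  have hre : ∀ r : ℝ, (∀ t : ℝ, 0 ≤ t * r + d.re) → r = 0 := by
    intro r h
    by_contra hne
    have := h (-(d.re + 1) / r)
    rw [div_mul_cancel₀ _ hne] at this
    linarith
  have h1 : w.re + v.re = 0 := hre _ fun t => by have := (k1 t).1; linarith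
  have h2 := (k1 1).2
  have h3 : w.im - v.im = 0 := hre _ fun t => by have := (k2 t).1; linarith
  have h4 := (k2 1).2
  apply Complex.ext <;> simp <;> linarith

/-- Since `f(1 - P) = 0`, Cauchy–Schwarz annihilates `(1 - P)X`. -/
theorem IsPositiveFunctional.mul_left_of_isState (hf : IsState M f) {P : M.toStarSubalgebra}
    (hP : P * P = P) (hPs : star P = P) (hfP : f P = 1) (X : M.toStarSubalgebra) :
    f (P * X) = f X := by
  have h : f ((1 - P) * star (1 - P)) = 0 := by
    rw [star_sub, star_one, hPs, sub_mul, mul_sub, mul_sub, hP]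
    simp [hf.2, hfP]
  have := hf.1.apply_mul_eq_zero h X
  rw [sub_mul, one_mul, map_sub, sub_eq_zero] at this
  exact this.symm

theorem isPositive_norm_smul_one_sub {X : H →L[ℂ] H} (hX : IsSelfAdjoint X) :
    ((‖X‖ : ℂ) • (1 : H →L[ℂ] H) - X).IsPositive := by
  rw [ContinuousLinearMap.isPositive_def']
  refine ⟨?_, fun x => ?_⟩
  · refine IsSelfAdjoint.sub ?_ hX
    exact IsSelfAdjoint.smul (by simp [IsSelfAdjoint]) (IsSelfAdjoint.one _)
  · rw [ContinuousLinearMap.reApplyInnerSelf_apply]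
    have h1 : (⟪X x, x⟫_ℂ).re ≤ ‖X‖ * ‖x‖ * ‖x‖ :=
      (Complex.re_le_norm _).trans ((norm_inner_le_norm _ _).trans
        (by gcongr; exact X.le_opNorm x))
    have h2 : (⟪(‖X‖ : ℂ) • x, x⟫_ℂ).re = ‖X‖ * ‖x‖ * ‖x‖ := by
      rw [inner_smul_left, inner_self_eq_norm_sq_to_K]
      simp
      norm_cast
      simp [pow_two, mul_assoc]
    simp [inner_sub_left] at h1 h2 ⊢
    linarith

theorem IsState.apply_le_norm (hf : IsState M f) {X : M.toStarSubalgebra}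
    (hX : IsSelfAdjoint X) : f X ≤ (‖X‖ : ℂ) := by
  have hp : ((((‖X‖ : ℂ) • (1 : M.toStarSubalgebra) - X : M.toStarSubalgebra)) :
      H →L[ℂ] H).IsPositive :=
    isPositive_norm_smul_one_sub (X := (X : H →L[ℂ] H)) (congrArg Subtype.val hX)
  have := hf.1 _ hp
  rw [map_sub, map_smul, hf.2] at this
  simpa using this

theorem IsState.im_apply_eq_zero (hf : IsState M f) {X : M.toStarSubalgebra}
    (hX : IsSelfAdjoint X) : (f X).im = 0 := by
  simpa using (Complex.le_def.1 (hf.apply_le_norm hX)).2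

theorem IsState.norm_apply_le_of_isSelfAdjoint (hf : IsState M f) {X : M.toStarSubalgebra}
    (hX : IsSelfAdjoint X) : ‖f X‖ ≤ ‖X‖ := by
  have h1 : (f X).re ≤ ‖X‖ := (Complex.le_def.1 (hf.apply_le_norm hX)).1
  have h2 := (Complex.le_def.1 (hf.apply_le_norm hX.neg)).1
  rw [map_neg, norm_neg, Complex.neg_re, Complex.ofReal_re] at h2
  have him : f X = ((f X).re : ℂ) := Complex.ext (by simp) (by simp [hf.im_apply_eq_zero hX])
  rw [him, Complex.norm_real, Real.norm_eq_abs, abs_le]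
  constructor <;> linarith

/-- The crude constant 2, from real and imaginary parts, suffices to place the states in a
Banach–Alaoglu ball. -/
theorem IsState.norm_apply_le (hf : IsState M f) (X : M.toStarSubalgebra) :
    ‖f X‖ ≤ 2 * ‖X‖ := by
  have hd := realPart_add_I_smul_imaginaryPart X
  have h1 := hf.norm_apply_le_of_isSelfAdjoint (realPart X).2
  have h2 := hf.norm_apply_le_of_isSelfAdjoint (imaginaryPart X).2
  have h3 : ‖((realPart X : selfAdjoint _) : M.toStarSubalgebra)‖ ≤ ‖X‖ := realPart.norm_le X
  have h4 : ‖((imaginaryPart X : selfAdjoint _) : M.toStarSubalgebra)‖ ≤ ‖X‖ :=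
    imaginaryPart.norm_le X
  calc ‖f X‖ = ‖f (realPart X : M.toStarSubalgebra)
        + Complex.I * f (imaginaryPart X : M.toStarSubalgebra)‖ := by
        conv_lhs => rw [← hd, map_add, map_smul, smul_eq_mul]
    _ ≤ ‖f (realPart X : M.toStarSubalgebra)‖
        + ‖Complex.I * f (imaginaryPart X : M.toStarSubalgebra)‖ := norm_add_le _ _
    _ ≤ 2 * ‖X‖ := by rw [norm_mul, Complex.norm_I]; linarith

end Functional

/-! ### Elements of finite seminorm -/

section ABounded

variable {M : VonNeumannAlgebra H} {A : M.toStarSubalgebra}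

/-- If `Ay = 0`, any multiple of the vector functional at `y` can be added to a normalised
functional without changing its value at `A`. Finiteness of the seminorm then forces `⟪y, T*ATy⟫ =
0`, that is `PTy = 0`; this is applied to `y = x - Px`. -/
theorem mul_eq_of_mem_aBounded (hA : (A : H →L[ℂ] H).IsPositive) (hA0 : A ≠ 0)
    (hws : WellSupported M A) {T : M.toStarSubalgebra} (hT : T ∈ aBounded M A) :
    rangeProjection M A * T = rangeProjection M A * T * rangeProjection M A := by
  obtain ⟨c, hc, hle⟩ := exists_rangeProjection_le hA hws
  obtain ⟨w, hw⟩ : ∃ w : H, 0 < (⟪w, (A : H →L[ℂ] H) w⟫_ℂ).re := by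
    by_contra! hcon
    refine hA0 ?_
    have hP : rangeProjection M A = 0 := by
      refine Subtype.ext (ContinuousLinearMap.ext fun x => ?_)
      have := hle x
      have h2 := mul_nonpos_of_nonneg_of_nonpos hc (hcon x)
      have : ‖(rangeProjection M A : H →L[ℂ] H) x‖ = 0 :=
        pow_eq_zero_iff two_ne_zero |>.1 (le_antisymm (this.trans h2) (by positivity))
      exact norm_eq_zero.1 this
    rw [← rangeProjection_mul (M := M) (A := A), hP, zero_mul]
  have hwA : vectorFunctional M w A = ((⟪w, (A : H →L[ℂ] H) w⟫_ℂ).re : ℂ) := by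
    have := (Complex.nonneg_iff.1 (hA.inner_nonneg_right w)).2
    exact Complex.ext rfl (by simpa [vectorFunctional_apply] using this.symm)
  set r : ℝ := (⟪w, (A : H →L[ℂ] H) w⟫_ℂ).re
  have hnull : ∀ y : H, (A : H →L[ℂ] H) y = 0 →
      (rangeProjection M A : H →L[ℂ] H) ((T : H →L[ℂ] H) y) = 0 := by
    intro y hy
    set D := star T * A * T
    have hDpos : (D : H →L[ℂ] H).IsPositive := hA.adjoint_conj (T : H →L[ℂ] H)
    set d : ℝ := (vectorFunctional M y D).re with hd
    have hd0 : 0 ≤ d := (Complex.nonneg_iff.1 (hDpos.inner_nonneg_right y)).1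
    have hfun : ∀ t : ℝ, 0 ≤ t →
        ENNReal.ofReal (Real.sqrt (t * d)) ≤ aSeminorm M A T := by
      intro t ht
      have hpos : IsPositiveFunctional M
          (((r⁻¹ : ℝ) : ℂ) • vectorFunctional M w + (t : ℂ) • vectorFunctional M y) :=
        ((isPositiveFunctional_vectorFunctional M w).smul (inv_nonneg.2 hw.le)).add
          ((isPositiveFunctional_vectorFunctional M y).smul ht)
      have hone : (((r⁻¹ : ℝ) : ℂ) • vectorFunctional M w
          + (t : ℂ) • vectorFunctional M y) A = 1 := by
        have hy' : vectorFunctional M y A = 0 := by rw [vectorFunctional_apply, hy, inner_zero_right]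
        simp only [add_apply, smul_apply, hwA, hy', smul_eq_mul, mul_zero, add_zero]
        rw [← Complex.ofReal_mul, inv_mul_cancel₀ hw.ne', Complex.ofReal_one]
      refine le_trans (ENNReal.ofReal_le_ofReal (Real.sqrt_le_sqrt ?_))
        (le_iSup (fun f : {f : StrongDual ℂ M.toStarSubalgebra //
          IsPositiveFunctional M f ∧ f A = 1} =>
          ENNReal.ofReal (Real.sqrt (f.1 (star T * A * T)).re)) ⟨_, hpos, hone⟩)
      have h0 : 0 ≤ (vectorFunctional M w D).re :=
        (Complex.nonneg_iff.1 (hDpos.inner_nonneg_right w)).1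
      change t * d ≤ ((((r⁻¹ : ℝ) : ℂ) • vectorFunctional M w + (t : ℂ) • vectorFunctional M y) D).re
      simp only [add_apply, smul_apply, smul_eq_mul, Complex.add_re, Complex.re_ofReal_mul]
      have : 0 ≤ r⁻¹ * (vectorFunctional M w D).re := mul_nonneg (inv_nonneg.2 hw.le) h0
      linarith
    have hdz : d = 0 := by
      by_contra hne
      have hdp : 0 < d := lt_of_le_of_ne hd0 (Ne.symm hne)
      set C := (aSeminorm M A T).toReal
      have hC0 : 0 ≤ C := ENNReal.toReal_nonneg
      -- This weight would force the seminorm `C` to be at least `C + 1`.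
      have hC := hfun ((C + 1) ^ 2 / d) (by positivity)
      rw [div_mul_cancel₀ _ hne, Real.sqrt_sq (by positivity),
        ENNReal.ofReal_le_iff_le_toReal (ne_of_lt hT)] at hC
      change C + 1 ≤ C at hC
      linarith
    have h1 := hle ((T : H →L[ℂ] H) y)
    have h2 : (⟪(T : H →L[ℂ] H) y, (A : H →L[ℂ] H) ((T : H →L[ℂ] H) y)⟫_ℂ).re = d := by
      rw [hd, vectorFunctional_apply]
      change _ = (⟪y, ContinuousLinearMap.adjoint (T : H →L[ℂ] H)
        ((A : H →L[ℂ] H) ((T : H →L[ℂ] H) y))⟫_ℂ).re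
      rw [ContinuousLinearMap.adjoint_inner_right]
    rw [h2, hdz, mul_zero] at h1
    exact norm_eq_zero.1 (pow_eq_zero_iff two_ne_zero |>.1 (le_antisymm h1 (by positivity)))
  refine Subtype.ext (ContinuousLinearMap.ext fun x => ?_)
  have hAP := congrArg (fun Z : M.toStarSubalgebra => (Z : H →L[ℂ] H) x) (mul_rangeProjection hA)
  have h := hnull (x - (rangeProjection M A : H →L[ℂ] H) x) (by
    rw [map_sub, sub_eq_zero]; exact hAP.symm)
  rw [map_sub, map_sub, sub_eq_zero] at h
  exact h

/-- Here `D = T*AT` satisfies `D = PDP ≤ ‖D‖P ≤ ‖D‖cA`, so `f(D) ≤ ‖D‖c` whenever `f(A) = 1`. -/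
theorem mem_aBounded_of_mul_eq (hA : (A : H →L[ℂ] H).IsPositive)
    (hws : WellSupported M A) {T : M.toStarSubalgebra}
    (hT : rangeProjection M A * T = rangeProjection M A * T * rangeProjection M A) :
    T ∈ aBounded M A := by
  obtain ⟨c, hc, hle⟩ := exists_rangeProjection_le hA hws
  set P := rangeProjection M A
  set D := star T * A * T with hD
  have hAT : A * T = A * T * P := by
    have hAP : A * P = A := mul_rangeProjection hA
    calc A * T = A * (P * T) := by rw [← mul_assoc, hAP]
      _ = A * P * T * P := by rw [hT]; simp only [mul_assoc]
      _ = A * T * P := by rw [hAP]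
  have hDP : D = star P * (D * P) := by
    have h1 : D = D * P := by rw [hD, mul_assoc, hAT]; simp only [mul_assoc, rangeProjection_mul_self, P]
    have h2 : star D = D := Subtype.ext (hA.adjoint_conj (T : H →L[ℂ] H)).isSelfAdjoint
    rw [← h1]
    calc D = star D := h2.symm
      _ = star P * star D := by conv_lhs => rw [h1, star_mul]
      _ = star P * D := by rw [h2]
  have hpos : (((((‖D‖ * c : ℝ) : ℂ) • A - D : M.toStarSubalgebra)) : H →L[ℂ] H).IsPositive := by
    rw [ContinuousLinearMap.isPositive_def']
    have hDs : IsSelfAdjoint (D : H →L[ℂ] H) := (hA.adjoint_conj (T : H →L[ℂ] H)).isSelfAdjoint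
    refine ⟨?_, fun x => ?_⟩
    · refine IsSelfAdjoint.sub ?_ hDs
      exact IsSelfAdjoint.smul (by simp [IsSelfAdjoint]) hA.isSelfAdjoint
    · rw [ContinuousLinearMap.reApplyInnerSelf_apply]
      have h1 : (⟪x, (D : H →L[ℂ] H) x⟫_ℂ).re ≤ ‖D‖ * ‖(P : H →L[ℂ] H) x‖ ^ 2 := by
        have e : (D : H →L[ℂ] H) x = ContinuousLinearMap.adjoint (P : H →L[ℂ] H)
            ((D : H →L[ℂ] H) ((P : H →L[ℂ] H) x)) :=
          congrArg (fun Z : M.toStarSubalgebra => (Z : H →L[ℂ] H) x) hDP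
        rw [e, ContinuousLinearMap.adjoint_inner_right]
        refine (Complex.re_le_norm _).trans ((norm_inner_le_norm _ _).trans ?_)
        have := (D : H →L[ℂ] H).le_opNorm ((P : H →L[ℂ] H) x)
        calc _ ≤ ‖(P : H →L[ℂ] H) x‖ * (‖(D : H →L[ℂ] H)‖ * ‖(P : H →L[ℂ] H) x‖) := by gcongr
          _ = ‖(D : H →L[ℂ] H)‖ * ‖(P : H →L[ℂ] H) x‖ ^ 2 := by ring
      have h2 := mul_le_mul_of_nonneg_left (hle x) (norm_nonneg D)
      change 0 ≤ (⟪(((‖D‖ * c : ℝ) : ℂ) • (A : H →L[ℂ] H) x - (D : H →L[ℂ] H) x), x⟫_ℂ).re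
      rw [inner_sub_left, inner_smul_left, Complex.conj_ofReal, Complex.sub_re,
        Complex.re_ofReal_mul, ← inner_conj_symm, ← inner_conj_symm ((D : H →L[ℂ] H) x),
        Complex.conj_re, Complex.conj_re]
      linarith
  refine lt_of_le_of_lt (iSup_le fun f => ?_)
    (ENNReal.ofReal_lt_top (r := Real.sqrt (‖D‖ * c)))
  refine ENNReal.ofReal_le_ofReal (Real.sqrt_le_sqrt ?_)
  have h := (Complex.nonneg_iff.1 (f.2.1 _ hpos)).1
  rw [map_sub, map_smul, f.2.2] at h
  simpa using h

end ABounded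

/-! ### Pure states annihilating a singular positive element -/

section PureState

variable {M : VonNeumannAlgebra H}

/-- The state space of `M`, as a subset of the weak-star dual. -/
def stateSpace (M : VonNeumannAlgebra H) : Set (WeakDual ℂ M.toStarSubalgebra) :=
  {φ | IsState M (WeakDual.toStrongDual φ)}

theorem isCompact_stateSpace : IsCompact (stateSpace M) := by
  have hsub : stateSpace M ⊆ WeakDual.toStrongDual ⁻¹'
      Metric.closedBall (0 : StrongDual ℂ M.toStarSubalgebra) 2 := by
    intro φ hφ
    rw [Set.mem_preimage, mem_closedBall_zero_iff]
    exact ContinuousLinearMap.opNorm_le_bound _ zero_le_two fun X =>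
      IsState.norm_apply_le hφ X
  refine (WeakDual.isCompact_closedBall 0 2).of_isClosed_subset ?_ hsub
  have : stateSpace M = (⋂ (X : M.toStarSubalgebra) (_ : (X : H →L[ℂ] H).IsPositive),
      {φ | 0 ≤ φ X}) ∩ {φ | φ 1 = 1} := by
    ext φ
    simp only [Set.mem_inter_iff, Set.mem_iInter, Set.mem_ofPred_eq]
    rfl
  rw [this]
  refine IsClosed.inter (isClosed_iInter fun X => isClosed_iInter fun _ => ?_) ?_
  · exact isClosed_le continuous_const (WeakDual.eval_continuous X)
  · exact isClosed_eq (WeakDual.eval_continuous 1) continuous_const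

theorem IsPositiveFunctional.eq_zero_of_apply_one {f : StrongDual ℂ M.toStarSubalgebra}
    (hf : IsPositiveFunctional M f) (h1 : f 1 = 0) : f = 0 := by
  ext X
  simpa using hf.apply_mul_eq_zero (X := 1) (by simpa using h1) X

theorem IsPositiveFunctional.apply_one_eq_re {f : StrongDual ℂ M.toStarSubalgebra}
    (hf : IsPositiveFunctional M f) : f 1 = ((f 1).re : ℂ) ∧ 0 ≤ (f 1).re := by
  have h : 0 ≤ f 1 := hf 1 ContinuousLinearMap.isPositive_one
  have := Complex.nonneg_iff.1 h
  exact ⟨Complex.ext rfl (by simpa using this.2.symm), this.1⟩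

theorem isState_inv_smul {f : StrongDual ℂ M.toStarSubalgebra}
    (hf : IsPositiveFunctional M f) {r : ℝ} (hr : 0 < r) (h1 : f 1 = (r : ℂ)) :
    IsState M (((r⁻¹ : ℝ) : ℂ) • f) := by
  refine ⟨hf.smul (inv_nonneg.2 hr.le), ?_⟩
  change ((r⁻¹ : ℝ) : ℂ) * f 1 = 1
  rw [h1, ← Complex.ofReal_mul, inv_mul_cancel₀ hr.ne', Complex.ofReal_one]

/-- For `0 ≤ g ≤ f` and `α = g(1)` strictly between 0 and 1, `f` is the convex combination of `g/α`
and `(f - g)/(1 - α)`. At the endpoints `g` or `f - g` vanishes at 1, hence everywhere. -/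
theorem isPureState_of_mem_extremePoints {φ : WeakDual ℂ M.toStarSubalgebra}
    (hφ : φ ∈ (stateSpace M).extremePoints ℝ) : IsPureState M (WeakDual.toStrongDual φ) := by
  refine ⟨hφ.1, fun g hg hle => ?_⟩
  set f := WeakDual.toStrongDual φ with hf
  have hfs : IsState M f := hφ.1
  have hsub : IsPositiveFunctional M (f - g) := fun X hX => sub_nonneg.2 (hle X hX)
  obtain ⟨hgr, hg0⟩ := hg.apply_one_eq_re
  set α : ℝ := (g 1).re
  have hs1 : (f - g) 1 = ((1 - α : ℝ) : ℂ) := by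
    rw [sub_apply, hfs.2, hgr]; push_cast; rfl
  have hα1 : α ≤ 1 := by
    have := hsub.apply_one_eq_re.2
    rw [hs1, Complex.ofReal_re] at this
    linarith
  rcases hg0.eq_or_lt with h0 | h0
  · refine ⟨0, le_rfl, zero_le_one, ?_⟩
    rw [hg.eq_zero_of_apply_one (by rw [hgr, ← h0]; simp)]
    ext X
    change 0 = ((0 : ℝ) : ℂ) * f X
    simp
  rcases hα1.eq_or_lt with h1 | h1
  · refine ⟨1, zero_le_one, le_rfl, ?_⟩
    have := hsub.eq_zero_of_apply_one (by rw [hs1, h1]; simp)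
    rw [sub_eq_zero] at this
    simp [this]
  refine ⟨α, h0.le, hα1, ?_⟩
  have hs := isState_inv_smul hg h0 hgr
  have ht := isState_inv_smul hsub (sub_pos.2 h1) hs1
  have hseg : φ ∈ openSegment ℝ
      (StrongDual.toWeakDual (((α⁻¹ : ℝ) : ℂ) • g))
      (StrongDual.toWeakDual ((((1 - α)⁻¹ : ℝ) : ℂ) • (f - g))) := by
    refine ⟨α, 1 - α, h0, sub_pos.2 h1, by ring, ?_⟩
    refine DFunLike.ext _ _ fun X => ?_
    change (α : ℂ) * (((α⁻¹ : ℝ) : ℂ) * g X)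
      + ((1 - α : ℝ) : ℂ) * ((((1 - α)⁻¹ : ℝ) : ℂ) * (f X - g X)) = f X
    rw [← mul_assoc, ← mul_assoc, ← Complex.ofReal_mul, ← Complex.ofReal_mul,
      mul_inv_cancel₀ h0.ne', mul_inv_cancel₀ (sub_pos.2 h1).ne']
    simp
  have heq : ((α⁻¹ : ℝ) : ℂ) • g = f :=
    congrArg WeakDual.toStrongDual (hφ.2 (x₁ := StrongDual.toWeakDual (((α⁻¹ : ℝ) : ℂ) • g))
      hs ht hseg)
  rw [← heq, smul_smul, ← Complex.ofReal_mul, mul_inv_cancel₀ h0.ne']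
  simp

theorem isState_vectorFunctional {x : H} (hx : ‖x‖ = 1) :
    IsState M (vectorFunctional M x) := by
  refine ⟨isPositiveFunctional_vectorFunctional M x, ?_⟩
  change ⟪x, x⟫_ℂ = 1
  rw [inner_self_eq_norm_sq_to_K, hx]; simp

/-- Compactness yields a state minimising the value at `Z`. A positive minimum, tested on vector
states, would bound `Z` below and make it invertible. -/
theorem exists_isState_apply_eq_zero {Z : M.toStarSubalgebra}
    (hZ : (Z : H →L[ℂ] H).IsPositive) (hu : ¬ IsUnit Z) :
    ∃ φ ∈ stateSpace M, φ Z = 0 := by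
  have hnt : Nontrivial H := by
    by_contra h
    rw [not_nontrivial_iff_subsingleton] at h
    exact hu (isUnit_of_subsingleton _)
  obtain ⟨x, hx⟩ := exists_norm_eq H zero_le_one
  have hne : (stateSpace M).Nonempty :=
    ⟨StrongDual.toWeakDual (vectorFunctional M x), isState_vectorFunctional hx⟩
  obtain ⟨φ, hφ, hmin⟩ := isCompact_stateSpace.exists_isMinOn hne
    (Complex.continuous_re.comp (WeakDual.eval_continuous Z)).continuousOn
  refine ⟨φ, hφ, ?_⟩
  have hnn := Complex.nonneg_iff.1 (hφ.1 Z hZ)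
  by_contra hne0
  have hpos : 0 < (φ Z).re := by
    refine lt_of_le_of_ne hnn.1 fun h => hne0 ?_
    exact Complex.ext h.symm hnn.2.symm
  refine hu ((isUnit_iff_isUnit_coe M Z).2 ?_)
  refine ContinuousLinearMap.isUnit_of_forall_le_norm_inner_map (Z : H →L[ℂ] H)
    (c := ⟨(φ Z).re, hpos.le⟩) hpos fun y => ?_
  change ‖y‖ ^ 2 * (φ Z).re ≤ _
  rcases eq_or_ne y 0 with rfl | hy
  · simp
  have hyn : 0 < ‖y‖ := norm_pos_iff.2 hy
  have hunit : ‖((‖y‖⁻¹ : ℝ) : ℂ) • y‖ = 1 := by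
    rw [norm_smul, Complex.norm_real, norm_inv, norm_norm, inv_mul_cancel₀ hyn.ne']
  have h := hmin (show StrongDual.toWeakDual (vectorFunctional M (((‖y‖⁻¹ : ℝ) : ℂ) • y)) ∈
    stateSpace M from isState_vectorFunctional hunit)
  have h' : (φ Z).re ≤ (⟪((‖y‖⁻¹ : ℝ) : ℂ) • y,
    (Z : H →L[ℂ] H) (((‖y‖⁻¹ : ℝ) : ℂ) • y)⟫_ℂ).re := h
  rw [map_smul, inner_smul_left, inner_smul_right, Complex.conj_ofReal, Complex.re_ofReal_mul,
    Complex.re_ofReal_mul] at h'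
  calc ‖y‖ ^ 2 * (φ Z).re
      ≤ ‖y‖ ^ 2 * (‖y‖⁻¹ * (‖y‖⁻¹ * (⟪y, (Z : H →L[ℂ] H) y⟫_ℂ).re)) := by gcongr
    _ = (⟪y, (Z : H →L[ℂ] H) y⟫_ℂ).re := by field_simp
    _ ≤ ‖⟪y, (Z : H →L[ℂ] H) y⟫_ℂ‖ := Complex.re_le_norm _
    _ = _ := norm_inner_symm _ _

/-- The states vanishing at the positive element `Z` form a closed face, so an extreme point of that
face is extreme among all states. -/
theorem exists_isPureState_apply_eq_zero {Z : M.toStarSubalgebra}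
    (hZ : (Z : H →L[ℂ] H).IsPositive) (hu : ¬ IsUnit Z) :
    ∃ g : StrongDual ℂ M.toStarSubalgebra, IsPureState M g ∧ g Z = 0 := by
  set F : Set (WeakDual ℂ M.toStarSubalgebra) := stateSpace M ∩ {φ | φ Z = 0}
  have hF : IsCompact F := isCompact_stateSpace.inter_right
    (isClosed_eq (WeakDual.eval_continuous Z) continuous_const)
  have hFne : F.Nonempty := exists_isState_apply_eq_zero hZ hu
  have hext : IsExtreme ℝ (stateSpace M) F := by
    refine ⟨Set.inter_subset_left, ?_⟩
    rintro φ hφ ψ hψ χ hχ ⟨a, b, ha, hb, -, rfl⟩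
    have hz : (a : ℂ) * φ Z + (b : ℂ) * ψ Z = 0 := hχ.2
    have h1 : 0 ≤ φ Z := hφ.1 Z hZ
    have h2 : 0 ≤ ψ Z := hψ.1 Z hZ
    have ha' : (0 : ℂ) < a := by exact_mod_cast ha
    have hb' : (0 : ℂ) < b := by exact_mod_cast hb
    have := (add_eq_zero_iff_of_nonneg (mul_nonneg ha'.le h1) (mul_nonneg hb'.le h2)).1 hz
    exact ⟨hφ, (mul_eq_zero.1 this.1).resolve_left ha'.ne'⟩
  have : LocallyConvexSpace ℝ (WeakDual ℂ M.toStarSubalgebra) :=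
    Topology.IsInducing.locallyConvexSpace
      (f := ({ toFun := fun φ X => φ X
               map_add' := fun _ _ => rfl
               map_smul' := fun _ _ => rfl } :
        WeakDual ℂ M.toStarSubalgebra →ₗ[ℝ] (M.toStarSubalgebra → ℂ)))
      ⟨rfl⟩
  obtain ⟨φ, hφ⟩ := hF.extremePoints_nonempty hFne
  exact ⟨WeakDual.toStrongDual φ,
    isPureState_of_mem_extremePoints (hext.extremePoints_subset_extremePoints hφ), hφ.1.2⟩

end PureState

/-! ### The `A`-spectrum of a well-supported positive element -/

section Spectrum

variable {M : VonNeumannAlgebra H} {A : M.toStarSubalgebra}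

local notation "ℙ" => rangeProjection M A

theorem mem_aBounded_iff (hA : (A : H →L[ℂ] H).IsPositive) (hA0 : A ≠ 0)
    (hws : WellSupported M A) {T : M.toStarSubalgebra} :
    T ∈ aBounded M A ↔ ℙ * T = ℙ * T * ℙ :=
  ⟨mul_eq_of_mem_aBounded hA hA0 hws, mem_aBounded_of_mul_eq hA hws⟩

theorem rangeProjection_mul_smul_sub {T : M.toStarSubalgebra} (hT : ℙ * T = ℙ * T * ℙ) (z : ℂ) :
    ℙ * (z • 1 - T) = ℙ * (z • 1 - T) * ℙ := by
  simp only [mul_sub, sub_mul, mul_smul_comm, smul_mul_assoc, mul_one, rangeProjection_mul_self]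
  rw [← hT]

theorem mul_eq_iff_rangeProjection_mul_eq (hA : (A : H →L[ℂ] H).IsPositive)
    (hws : WellSupported M A) {X : M.toStarSubalgebra} : A * X = A ↔ ℙ * X = ℙ := by
  obtain ⟨B, -, -, hBA, -, -⟩ := exists_pseudoinverse hA hws
  constructor
  · intro h
    rw [← hBA, mul_assoc, h]
  · intro h
    rw [← mul_rangeProjection hA, mul_assoc, h]

theorem not_isRightAInvertible_iff (hA : (A : H →L[ℂ] H).IsPositive)
    (hws : WellSupported M A) {X : M.toStarSubalgebra} :
    ¬ IsRightAInvertible M A X ↔ ∃ g : StrongDual ℂ M.toStarSubalgebra,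
      IsPureState M g ∧ g ℙ = 1 ∧ ∀ S, g (X * S) = 0 := by
  have hPP : ℙ * ℙ = ℙ := rangeProjection_mul_self
  have hPs : star ℙ = ℙ := star_rangeProjection
  constructor
  · intro hn
    set Y := ℙ * X with hY
    have hPY : ℙ * Y = Y := by rw [hY, ← mul_assoc, hPP]
    have hYY : ((Y * star Y : M.toStarSubalgebra) : H →L[ℂ] H).IsPositive := by
      simpa only [star_star] using star_mul_self_isPositive M (star Y)
    have hQQ : ((1 - ℙ : M.toStarSubalgebra) : H →L[ℂ] H).IsPositive := by
      have h := star_mul_self_isPositive M (1 - ℙ)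
      have e : star (1 - ℙ) * (1 - ℙ) = 1 - ℙ := by
        rw [star_sub, star_one, hPs, sub_mul, mul_sub, mul_sub, hPP]; simp
      rwa [e] at h
    have hu : ¬ IsUnit (Y * star Y + (1 - ℙ)) := by
      rintro ⟨V, hV⟩
      -- Since `PV = YY*`, the element `Y*V⁻¹` is a right inverse of `Y` relative to `P`; the final
      -- factor `P` puts it in `M^A`.
      refine hn ⟨star Y * ↑V⁻¹ * ℙ, mem_aBounded_of_mul_eq hA hws ?_, ?_⟩
      · simp only [mul_assoc, hPP]
      · rw [mul_assoc, mul_eq_iff_rangeProjection_mul_eq hA hws]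
        have h1 : ℙ * (V : M.toStarSubalgebra) = Y * star Y := by
          rw [hV, mul_add, ← mul_assoc, hPY, mul_sub, mul_one, hPP, sub_self, add_zero]
        calc ℙ * (X * (star Y * ↑V⁻¹ * ℙ)) = Y * star Y * ↑V⁻¹ * ℙ := by
              simp only [hY, mul_assoc]
          _ = ℙ := by rw [← h1, mul_assoc ℙ, Units.mul_inv, mul_one, hPP]
    obtain ⟨g, hg, hgz⟩ := exists_isPureState_apply_eq_zero (hYY.add hQQ) hu
    rw [map_add] at hgz
    obtain ⟨h1, h2⟩ := (add_eq_zero_iff_of_nonneg (hg.1.1 _ hYY) (hg.1.1 _ hQQ)).1 hgz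
    have hgP : g ℙ = 1 := by
      rw [map_sub, hg.1.2, sub_eq_zero] at h2
      exact h2.symm
    refine ⟨g, hg, hgP, fun S => ?_⟩
    rw [← IsPositiveFunctional.mul_left_of_isState hg.1 hPP hPs hgP, ← mul_assoc]
    exact hg.1.1.apply_mul_eq_zero h1 S
  · rintro ⟨g, hg, hgP, h⟩ ⟨S, -, hS⟩
    rw [mul_assoc, mul_eq_iff_rangeProjection_mul_eq hA hws] at hS
    have := IsPositiveFunctional.mul_left_of_isState hg.1 hPP hPs hgP (X * S)
    rw [hS, hgP, h S] at this
    exact one_ne_zero this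

theorem mem_rightASpectrum_iff (hA : (A : H →L[ℂ] H).IsPositive)
    (hws : WellSupported M A) {T : M.toStarSubalgebra} {z : ℂ} :
    z ∈ rightASpectrum M A T ↔ ∃ g ∈ rightMulPureStates M T, g ℙ = 1 ∧ z = g T := by
  refine (not_isRightAInvertible_iff hA hws).trans ?_
  have key : ∀ (g : StrongDual ℂ M.toStarSubalgebra) (S : M.toStarSubalgebra),
      g ((z • 1 - T) * S) = z * g S - g (T * S) := by
    intro g S
    rw [sub_mul, smul_mul_assoc, one_mul, map_sub, map_smul, smul_eq_mul]
  constructor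
  · rintro ⟨g, hg, hgP, h⟩
    have hz : g T = z := by
      have := h 1
      rw [key, hg.1.2, mul_one, mul_one, sub_eq_zero] at this
      exact this.symm
    refine ⟨g, ⟨hg, fun S => ?_⟩, hgP, hz.symm⟩
    have := h S
    rw [key, sub_eq_zero] at this
    rw [hz, this]
  · rintro ⟨g, ⟨hg, hmul⟩, hgP, rfl⟩
    exact ⟨g, hg, hgP, fun S => by rw [key, hmul, sub_self]⟩

/-- An `A`-adjoint `R = BS*A`: one has `AR = PS*A`, and the adjoint of `PS = PSP` removes the `P`.
-/
theorem exists_mem_aBounded_mul_eq_star_mul (hA : (A : H →L[ℂ] H).IsPositive) (hA0 : A ≠ 0)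
    (hws : WellSupported M A) {S : M.toStarSubalgebra} (hS : S ∈ aBounded M A) :
    ∃ R ∈ aBounded M A, A * R = star S * A := by
  obtain ⟨B, -, hAB, -, -, -⟩ := exists_pseudoinverse hA hws
  have hS' := congrArg star ((mem_aBounded_iff hA hA0 hws).1 hS)
  simp only [star_mul, star_rangeProjection] at hS'
  refine ⟨B * star S * A, mem_aBounded_of_mul_eq hA hws ?_, ?_⟩
  · simp only [mul_assoc, mul_rangeProjection hA]
  · calc A * (B * star S * A) = (A * B) * (star S * (ℙ * A)) := by
          rw [rangeProjection_mul]; simp only [mul_assoc]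
      _ = ℙ * (star S * ℙ) * A := by rw [hAB]; simp only [mul_assoc]
      _ = star S * A := by rw [← hS', mul_assoc, rangeProjection_mul]

theorem isRightAInvertible_of_isLeftAInvertible (hA : (A : H →L[ℂ] H).IsPositive) (hA0 : A ≠ 0)
    (hws : WellSupported M A) {X Y : M.toStarSubalgebra} (h : A * Y = star X * A)
    (hX : IsLeftAInvertible M A X) : IsRightAInvertible M A Y := by
  have hAs : star A = A := Subtype.ext hA.isSelfAdjoint
  obtain ⟨S, hS, hAS⟩ := hX
  obtain ⟨R, hR, hAR⟩ := exists_mem_aBounded_mul_eq_star_mul hA hA0 hws hS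
  refine ⟨R, hR, ?_⟩
  calc A * Y * R = star X * (A * R) := by rw [h, mul_assoc]
    _ = star (A * S * X) := by rw [hAR]; simp only [star_mul, hAs]
    _ = A := by rw [hAS, hAs]

theorem isLeftAInvertible_of_isRightAInvertible (hA : (A : H →L[ℂ] H).IsPositive) (hA0 : A ≠ 0)
    (hws : WellSupported M A) {X Y : M.toStarSubalgebra} (h : A * Y = star X * A)
    (hY : IsRightAInvertible M A Y) : IsLeftAInvertible M A X := by
  have hAs : star A = A := Subtype.ext hA.isSelfAdjoint
  obtain ⟨S, hS, hAS⟩ := hY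
  obtain ⟨R, hR, hAR⟩ := exists_mem_aBounded_mul_eq_star_mul hA hA0 hws hS
  refine ⟨R, hR, ?_⟩
  have h2 : A * X = star Y * A := by
    have := congrArg star h
    simp only [star_mul, star_star, hAs] at this
    exact this.symm
  calc A * R * X = star S * (A * X) := by rw [hAR, mul_assoc]
    _ = star (A * Y * S) := by rw [h2]; simp only [star_mul, hAs, mul_assoc]
    _ = A := by rw [hAS, hAs]

theorem mem_leftASpectrum_iff (hA : (A : H →L[ℂ] H).IsPositive) (hA0 : A ≠ 0)
    (hws : WellSupported M A) {T L : M.toStarSubalgebra}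
    (hTL : A * L = star T * A) {z : ℂ} :
    z ∈ leftASpectrum M A T ↔ ∃ g ∈ rightMulPureStates M L, g ℙ = 1 ∧ z = star (g L) := by
  have h : A * (star z • 1 - L) = star (z • 1 - T) * A := by
    rw [star_sub, star_smul, star_one, mul_sub, sub_mul, hTL, mul_smul_comm, smul_mul_assoc,
      mul_one, one_mul]
  have h1 : z ∈ leftASpectrum M A T ↔ star z ∈ rightASpectrum M A L :=
    not_congr ⟨isRightAInvertible_of_isLeftAInvertible hA hA0 hws h,
      isLeftAInvertible_of_isRightAInvertible hA hA0 hws h⟩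
  rw [h1, mem_rightASpectrum_iff hA hws]
  simp only [star_eq_iff_star_eq, @eq_comm _ z, @eq_comm _ (star z)]

theorem aSpectrum_sdiff_zero (hA : (A : H →L[ℂ] H).IsPositive) (hA0 : A ≠ 0)
    (hws : WellSupported M A) {T : M.toStarSubalgebra} (hT : T ∈ aBounded M A) :
    aSpectrum M A T \ {0} = spectrum ℂ (ℙ * T) \ {0} := by
  have hPP : ℙ * ℙ = ℙ := rangeProjection_mul_self
  have hPT := (mem_aBounded_iff hA hA0 hws).1 hT
  ext z
  simp only [Set.mem_sdiff, Set.mem_singleton_iff]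
  refine and_congr_left fun hz => not_congr ?_
  rw [spectrum.mem_resolventSet_iff, Algebra.algebraMap_eq_smul_one]
  set X := z • (1 : M.toStarSubalgebra) - T with hX
  set W := z • (1 : M.toStarSubalgebra) - ℙ * T with hW
  have hPX : ℙ * X = ℙ * X * ℙ := rangeProjection_mul_smul_sub hPT z
  have hPW : ℙ * W = ℙ * X := by
    rw [hW, hX, mul_sub, mul_sub, ← mul_assoc, hPP]
  have hWP : W * ℙ = ℙ * X := by
    rw [hW, hX, sub_mul, ← hPT, mul_sub, mul_smul_comm, smul_mul_assoc, one_mul, mul_one]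
  have hWQ : W = ℙ * X + z • (1 - ℙ) := by
    rw [hW, hX, mul_sub, mul_smul_comm, mul_one, smul_sub]; abel
  constructor
  · rintro ⟨S, hS, hXS, hSX⟩
    have hPS := (mem_aBounded_iff hA hA0 hws).1 hS
    rw [mul_assoc, mul_eq_iff_rangeProjection_mul_eq hA hws] at hXS hSX
    -- Blockwise inverse: `PS` inverts the corner and `z⁻¹` its complement.
    refine isUnit_iff_exists.2 ⟨ℙ * S + z⁻¹ • (1 - ℙ), ?_, ?_⟩
    · have e1 : ℙ * X * (ℙ * S) = ℙ := by rw [← mul_assoc, ← hPX, mul_assoc, hXS]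
      have e2 : ℙ * X * (1 - ℙ) = 0 := by rw [mul_sub, mul_one, ← hPX, sub_self]
      have e3 : (1 - ℙ) * (ℙ * S) = 0 := by rw [← mul_assoc, sub_mul, one_mul, hPP, sub_self, zero_mul]
      have e4 : (1 - ℙ) * (1 - ℙ) = 1 - ℙ := by rw [mul_sub, mul_one, sub_mul, one_mul, hPP]; simp
      rw [hWQ, add_mul, mul_add, mul_add, e1, mul_smul_comm, e2, smul_mul_assoc, e3,
        smul_mul_assoc, mul_smul_comm, e4, smul_smul, mul_inv_cancel₀ hz]
      simp
    · have e1 : ℙ * S * (ℙ * X) = ℙ := by rw [← mul_assoc, ← hPS, mul_assoc, hSX]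
      have e2 : ℙ * S * (1 - ℙ) = 0 := by rw [mul_sub, mul_one, ← hPS, sub_self]
      have e3 : (1 - ℙ) * (ℙ * X) = 0 := by rw [← mul_assoc, sub_mul, one_mul, hPP, sub_self, zero_mul]
      have e4 : (1 - ℙ) * (1 - ℙ) = 1 - ℙ := by rw [mul_sub, mul_one, sub_mul, one_mul, hPP]; simp
      rw [hWQ, add_mul, mul_add, mul_add, e1, mul_smul_comm, e2, smul_mul_assoc, e3,
        smul_mul_assoc, mul_smul_comm, e4, smul_smul, inv_mul_cancel₀ hz]
      simp
  · rintro ⟨V, hV⟩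
    have hcomm : Commute ℙ (V : M.toStarSubalgebra) := by
      rw [hV]; exact hPW.trans hWP.symm
    have hcomm' : ℙ * ↑V⁻¹ = ↑V⁻¹ * ℙ := hcomm.units_inv_right
    refine ⟨ℙ * ↑V⁻¹, mem_aBounded_of_mul_eq hA hws ?_, ?_, ?_⟩
    · rw [mul_assoc, mul_assoc, ← hcomm', ← mul_assoc ℙ ℙ, hPP, ← mul_assoc ℙ ℙ, hPP]
    · rw [mul_assoc, mul_eq_iff_rangeProjection_mul_eq hA hws]
      calc ℙ * (X * (ℙ * ↑V⁻¹)) = ℙ * X * ℙ * ↑V⁻¹ := by simp only [mul_assoc]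
        _ = ℙ := by rw [← hPX, ← hPW, ← hV, mul_assoc, Units.mul_inv, mul_one]
    · rw [mul_assoc, mul_eq_iff_rangeProjection_mul_eq hA hws]
      have h : ℙ * ↑V⁻¹ * X = ℙ := by
        rw [hcomm', mul_assoc, ← hWP, ← mul_assoc, ← hV, Units.inv_mul, one_mul]
      rw [h, hPP]

/-- In the corner a left and a right inverse coincide: `PS = PSXR = PR`. -/
theorem isAInvertible_of_left_of_right (hA : (A : H →L[ℂ] H).IsPositive) (hA0 : A ≠ 0)
    (hws : WellSupported M A) {X : M.toStarSubalgebra} (hl : IsLeftAInvertible M A X)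
    (hr : IsRightAInvertible M A X) : IsAInvertible M A X := by
  obtain ⟨S, hS, hSX⟩ := hl
  obtain ⟨R, hR, hXR⟩ := hr
  refine ⟨R, hR, hXR, ?_⟩
  have hPS := (mem_aBounded_iff hA hA0 hws).1 hS
  rw [mul_assoc, mul_eq_iff_rangeProjection_mul_eq hA hws] at hXR hSX ⊢
  have h : ℙ * S = ℙ * R := by
    calc ℙ * S = ℙ * S * ℙ := hPS
      _ = ℙ * S * (ℙ * (X * R)) := by rw [hXR]
      _ = (ℙ * S * ℙ) * X * R := by simp only [mul_assoc]
      _ = ℙ * (S * X) * R := by rw [← hPS]; simp only [mul_assoc]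
      _ = ℙ * R := by rw [hSX]
  rw [← mul_assoc, ← h, mul_assoc, hSX]

theorem im_eq_zero_of_mem_rightMulPureStates (hA : (A : H →L[ℂ] H).IsPositive)
    (hws : WellSupported M A) {T : M.toStarSubalgebra} (hT : A * T = star T * A)
    {g : StrongDual ℂ M.toStarSubalgebra} (hg : g ∈ rightMulPureStates M T) (hgP : g ℙ = 1) :
    (g T).im = 0 := by
  obtain ⟨B, hBs, hAB, hBA, -, hBP⟩ := exists_pseudoinverse hA hws
  obtain ⟨C, hCs, hCC⟩ := exists_sqrt hA
  -- `PTB = B(AT)B` is self-adjoint, so `g(PTB) = g(T)g(B)` is real; it remains to see that `g(B)`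
  -- is real and nonzero.
  have hsa : IsSelfAdjoint (ℙ * (T * B)) := by
    have e : ℙ * (T * B) = B * (star T * ℙ) := by
      calc ℙ * (T * B) = B * (A * T) * B := by rw [← hBA]; simp only [mul_assoc]
        _ = B * (star T * ℙ) := by rw [hT, ← hAB]; simp only [mul_assoc]
    rw [IsSelfAdjoint]
    conv_rhs => rw [e]
    simp only [star_mul, hBs, star_rangeProjection, mul_assoc]
  have h1 := hg.1.1.im_apply_eq_zero hsa
  rw [IsPositiveFunctional.mul_left_of_isState hg.1.1 rangeProjection_mul_self
    star_rangeProjection hgP, hg.2] at h1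
  have h2 : (g B).im = 0 := hg.1.1.im_apply_eq_zero hBs
  have h3 : g B ≠ 0 := by
    intro h0
    -- `B = (BC)(BC)*`, so `g(B) = 0` would force `g(BC·C) = g(P) = 0`.
    have hz : g (B * C * star (B * C)) = 0 := by
      rw [star_mul, hBs, hCs, mul_assoc, ← mul_assoc C, hCC, hAB, hBP, h0]
    have := hg.1.1.1.apply_mul_eq_zero hz C
    rw [mul_assoc, hCC, hBA, hgP] at this
    exact one_ne_zero this
  rw [Complex.mul_im, h2, mul_zero, zero_add] at h1
  exact (mul_eq_zero.1 h1).resolve_right fun h => h3 (Complex.ext h h2)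

theorem aSpectrum_subset_spectrum (hA : (A : H →L[ℂ] H).IsPositive) (hA0 : A ≠ 0)
    (hws : WellSupported M A) {T : M.toStarSubalgebra}
    (hT : A * T = star T * A) : aSpectrum M A T ⊆ spectrum ℂ T := by
  intro z hz
  by_contra hzs
  rw [spectrum.notMem_iff, Algebra.algebraMap_eq_smul_one] at hzs
  refine hz ?_
  by_cases him : z.im = 0
  · obtain ⟨V, hV⟩ := hzs
    set X := z • (1 : M.toStarSubalgebra) - T with hXdef
    have hAX : A * X = star X * A := by
      have hzz : star z = z := Complex.conj_eq_iff_im.2 him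
      rw [hXdef, star_sub, star_smul, star_one, hzz, mul_sub, sub_mul, hT, mul_smul_comm,
        smul_mul_assoc, mul_one, one_mul]
    have hVX : (↑V⁻¹ : M.toStarSubalgebra) * X = 1 := by rw [← hV, Units.inv_mul]
    have hXV : X * (↑V⁻¹ : M.toStarSubalgebra) = 1 := by rw [← hV, Units.mul_inv]
    set R : M.toStarSubalgebra := ↑V⁻¹
    -- For real `z` the relation `AX = X*A` passes to the inverse, which gives `PR = PRP`.
    have hAR : A * R = star R * A := by
      calc A * R = star (X * R) * A * R := by rw [hXV, star_one, one_mul]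
        _ = star R * (star X * A) * R := by simp only [star_mul, mul_assoc]
        _ = star R * A * (X * R) := by rw [← hAX]; simp only [mul_assoc]
        _ = star R * A := by rw [hXV, mul_one]
    refine ⟨R, mem_aBounded_of_mul_eq hA hws ?_, by rw [mul_assoc, hXV, mul_one],
      by rw [mul_assoc, hVX, mul_one]⟩
    obtain ⟨B, -, -, hBA, -, -⟩ := exists_pseudoinverse hA hws
    calc ℙ * R = B * (A * R) := by rw [← hBA, mul_assoc]
      _ = B * (A * R) * ℙ := by rw [hAR]; simp only [mul_assoc, mul_rangeProjection hA]
      _ = ℙ * R * ℙ := by rw [← hBA]; simp only [mul_assoc]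
  · refine isAInvertible_of_left_of_right hA hA0 hws ?_ ?_
    · by_contra h
      obtain ⟨g, hg, hgP, rfl⟩ := (mem_leftASpectrum_iff hA hA0 hws hT).1 h
      exact him (by simp [im_eq_zero_of_mem_rightMulPureStates hA hws hT hg hgP])
    · by_contra h
      obtain ⟨g, hg, hgP, rfl⟩ := (mem_rightASpectrum_iff hA hws).1 h
      exact him (im_eq_zero_of_mem_rightMulPureStates hA hws hT hg hgP)

end Spectrum

end ASpectrum

end

theorem proposition2p8 {H : Type*} [NormedAddCommGroup H] [InnerProductSpace ℂ H]
    [CompleteSpace H] (M : VonNeumannAlgebra H) (A : M.toStarSubalgebra)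
    (hA : (A : H →L[ℂ] H).IsPositive) (hA0 : A ≠ 0) (hws : ASpectrum.WellSupported M A)
    (T L : M.toStarSubalgebra) (hT : T ∈ ASpectrum.aBounded M A)
    (hL : L ∈ ASpectrum.aBounded M A) (hTL : A * L = star T * A) :
    ASpectrum.aSpectrum M A T \ {0}
        = spectrum ℂ (ASpectrum.rangeProjection M A * T) \ {0} ∧
    ASpectrum.rightASpectrum M A T \ {0}
        = {z : ℂ | ∃ g ∈ ASpectrum.rightMulPureStates M T,
            g (ASpectrum.rangeProjection M A) = 1 ∧ z = g T} \ {0} ∧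
    ASpectrum.leftASpectrum M A T \ {0}
        = {z : ℂ | ∃ g ∈ ASpectrum.rightMulPureStates M L,
            g (ASpectrum.rangeProjection M A) = 1 ∧ z = starRingEnd ℂ (g L)} \ {0} ∧
    (IsSelfAdjoint (A * T) → ASpectrum.aSpectrum M A T ⊆ spectrum ℂ T) := by
  refine ⟨ASpectrum.aSpectrum_sdiff_zero hA hA0 hws hT, ?_, ?_, fun h => ?_⟩
  · congr 1
    ext z
    exact ASpectrum.mem_rightASpectrum_iff hA hws
  · congr 1
    ext z
    exact ASpectrum.mem_leftASpectrum_iff hA hA0 hws hTL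
  · refine ASpectrum.aSpectrum_subset_spectrum hA hA0 hws ?_
    have hAs : star A = A := Subtype.ext hA.isSelfAdjoint
    rw [IsSelfAdjoint, star_mul, hAs] at h
    exact h.symm
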